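/- Let $\mathcal H$ and $\mathcal K$ be real or complex Hilbert spaces (over the same field), let $A,B:\mathcal H\to\mathcal K$ be bounded linear operators and let $\mathcal M,\mathcal N\subseteq\mathcal H$ be closed subspaces. Write $\mathcal R(\cdot)$ for the range of an operator, and call a linear operator $C:\mathcal D(C)\to\mathcal K$, with domain a linear subspace $\mathcal D(C)\subseteq\mathcal H$, closed if its graph is closed in $\mathcal H\times\mathcal K$. (1) There exists a closed operator $C$ with domain $\mathcal D(C)=\mathcal M+\mathcal N$ that coincides with $A$ on $\mathcal M$ and with $B$ on $\mathcal N$ if and only if $$\mathcal R(A^*-B^*)+\mathcal M^\perp+\mathcal N^\perp=\overline{\mathcal M^\perp+\mathcal N^\perp}.$$ (2) Suppose that $A$ and $B$ coincide on $\mathcal M\cap\mathcal N$, and let $C_{\mathcal M,\mathcal N}(A,B)$ be the (unique) operator with domain $\mathcal M+\mathcal N$ that coincides with $A$ on $\mathcal M$ and with $B$ on $\mathcal N$. Then $C_{\mathcal M,\mathcal N}(A,B)$ is closed if and only if $\mathcal R(A^*-B^*)+\mathcal M^\perp+\mathcal N^\perp=\overline{\mathcal M^\perp+\mathcal N^\perp}$,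 and also if and only if the subspace $\mathcal R(A^*-B^*)+\mathcal M^\perp+\mathcal N^\perp$ is closed. -/

import Mathlib

/-- The two restrictions `A|_M` and `B|_N` agree on the intersection of their domains as soon as
`A` and `B` coincide on `M ∩ N`. -/
theorem toPMap_agree {𝕜 H K : Type*} [RCLike 𝕜]
    [NormedAddCommGroup H] [InnerProductSpace 𝕜 H]
    [NormedAddCommGroup K] [InnerProductSpace 𝕜 K]
    (M N : Submodule 𝕜 H) (A B : H →L[𝕜] K) (hAB : ∀ x ∈ M ⊓ N, A x = B x)
    (x : ((A : H →ₗ[𝕜] K).toPMap M).domain) (y : ((B : H →ₗ[𝕜] K).toPMap N).domain)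
    (hxy : (x : H) = y) :
    (A : H →ₗ[𝕜] K).toPMap M x = (B : H →ₗ[𝕜] K).toPMap N y := by
  have hx : (x : H) ∈ M ⊓ N := ⟨x.2, hxy ▸ y.2⟩
  have h := hAB _ hx
  change A (x : H) = B (y : H)
  rw [h, hxy]

/-- The operator `C_{M,N}(A,B)` with domain `M + N` that coincides with `A` on `M` and with `B`
on `N`; it is defined when `A` and `B` coincide on `M ∩ N`. -/
noncomputable def inducedOperator {𝕜 H K : Type*} [RCLike 𝕜]
    [NormedAddCommGroup H] [InnerProductSpace 𝕜 H]
    [NormedAddCommGroup K] [InnerProductSpace 𝕜 K]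
    (M N : Submodule 𝕜 H) (A B : H →L[𝕜] K) (hAB : ∀ x ∈ M ⊓ N, A x = B x) : H →ₗ.[𝕜] K :=
  ((A : H →ₗ[𝕜] K).toPMap M).sup ((B : H →ₗ[𝕜] K).toPMap N) (toPMap_agree M N A B hAB)

/-- `IsSimultaneousExtension M N A B C`: the (not necessarily bounded) operator `C` has domain
`M + N`, coincides with `A` on `M` and coincides with `B` on `N`. -/
def IsSimultaneousExtension {𝕜 H K : Type*} [RCLike 𝕜]
    [NormedAddCommGroup H] [InnerProductSpace 𝕜 H]
    [NormedAddCommGroup K] [InnerProductSpace 𝕜 K]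
    (M N : Submodule 𝕜 H) (A B : H →L[𝕜] K) (C : H →ₗ.[𝕜] K) : Prop :=
  C.domain = M ⊔ N ∧
    (∀ x : C.domain, (x : H) ∈ M → C x = A x) ∧ (∀ x : C.domain, (x : H) ∈ N → C x = B x)

/-- `C_{M,N}(A,B)` is the one and only operator with domain `M + N` that coincides with `A` on `M`
and with `B` on `N`. -/
theorem isSimultaneousExtension_iff {𝕜 H K : Type*} [RCLike 𝕜]
    [NormedAddCommGroup H] [InnerProductSpace 𝕜 H]
    [NormedAddCommGroup K] [InnerProductSpace 𝕜 K]
    (M N : Submodule 𝕜 H) (A B : H →L[𝕜] K) (hAB : ∀ x ∈ M ⊓ N, A x = B x) (C : H →ₗ.[𝕜] K) :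
    IsSimultaneousExtension M N A B C ↔ C = inducedOperator M N A B hAB := by
  constructor
  · rintro ⟨hd, hA, hB⟩
    refine (LinearPMap.eq_of_le_of_domain_eq (LinearPMap.sup_le (toPMap_agree M N A B hAB) ?_ ?_) ?_).symm
    · refine ⟨by rw [hd]; exact le_sup_left, fun x y hxy => ?_⟩
      rw [hA y (hxy ▸ x.2), ← hxy]
      rfl
    · refine ⟨by rw [hd]; exact le_sup_right, fun x y hxy => ?_⟩
      rw [hB y (hxy ▸ x.2), ← hxy]
      rfl
    · rw [hd]
      rfl
  · rintro rfl
    refine ⟨rfl, fun x hx => ?_, fun x hx => ?_⟩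
    · exact ((LinearPMap.left_le_sup _ _ (toPMap_agree M N A B hAB)).2
        (x := ⟨(x : H), hx⟩) (y := x) rfl).symm
    · exact ((LinearPMap.right_le_sup _ _ (toPMap_agree M N A B hAB)).2
        (x := ⟨(x : H), hx⟩) (y := x) rfl).symm

/-! The graph of `C` is the sum of the graphs of `A|_M` and `B|_N`, two closed subspaces of the
Hilbert sum of `H` and `K`. Such a sum is closed iff the sum of the orthogonal complements is
(`isClosed_orthogonal_sup_iff`). The complement of the graph of `A|_M` is {(u, v) : u + A*v ∈ Mᗮ},
so the two complements add up to the preimage of S = R(A* - B*) + Mᗮ + Nᗮ under (u, v) ↦ u + A*v,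
which is closed exactly when S is.

Agreement of `A` and `B` on `M ⊓ N` means R(A* - B*) ⊆ (M ⊓ N)ᗮ, which is the closure of Mᗮ + Nᗮ.
Then S lies between Mᗮ + Nᗮ and its closure, so S is closed iff it equals that closure. Conversely,
this equality forces the agreement, which gives existence in (1). -/

/-- In a Hilbert space, if the sum of two closed subspaces is closed, then every vector orthogonal
to their intersection splits along the orthogonal complements. -/
theorem orthogonal_inf_le_sup_of_isClosed_sup {𝕜 E : Type*} [RCLike 𝕜]
    [NormedAddCommGroup E] [InnerProductSpace 𝕜 E] [CompleteSpace E] {X Y : Submodule 𝕜 E}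
    (hX : IsClosed (X : Set E)) (hY : IsClosed (Y : Set E))
    (h : IsClosed ((X ⊔ Y : Submodule 𝕜 E) : Set E)) : (X ⊓ Y)ᗮ ≤ Xᗮ ⊔ Yᗮ := by
  intro z hz
  have : CompleteSpace X := hX.completeSpace_coe
  have : CompleteSpace Y := hY.completeSpace_coe
  have : CompleteSpace (X ⊔ Y : Submodule 𝕜 E) := h.completeSpace_coe
  let T : (X × Y) →L[𝕜] (X ⊔ Y : Submodule 𝕜 E) :=
    (X.subtypeL.coprod Y.subtypeL).codRestrict (X ⊔ Y) fun p =>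
      Submodule.add_mem_sup p.1.2 p.2.2
  have hT : Function.Surjective T := by
    rintro ⟨s, hs⟩
    obtain ⟨x, hx, y, hy, rfl⟩ := Submodule.mem_sup.1 hs
    exact ⟨(⟨x, hx⟩, ⟨y, hy⟩), rfl⟩
  -- Open mapping theorem, where closedness of the sum enters: each s splits as x + y with ‖x‖ ≤
  -- c‖s‖.
  obtain ⟨c, hc, hcT⟩ := T.exists_preimage_norm_le hT
  -- Orthogonality of `z` to `X ⊓ Y` makes x + y ↦ ⟪z, x⟫ well defined on X + Y.
  have hagree : ∀ x ∈ X ⊓ Y, innerSL 𝕜 z x = (0 : E →L[𝕜] 𝕜) x := fun x hx => by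
    simpa using Submodule.inner_left_of_mem_orthogonal hx hz
  obtain ⟨-, hfX, hfY⟩ := (isSimultaneousExtension_iff X Y (innerSL 𝕜 z) 0 hagree _).2 rfl
  let f : (X ⊔ Y : Submodule 𝕜 E) →ₗ[𝕜] 𝕜 :=
    (inducedOperator X Y (innerSL 𝕜 z) 0 hagree).toFun
  have hf₁ : ∀ (x : E) (hx : x ∈ X), f ⟨x, Submodule.mem_sup_left hx⟩ = inner 𝕜 z x :=
    fun x hx => hfX ⟨x, Submodule.mem_sup_left hx⟩ hx
  have hf₂ : ∀ (y : E) (hy : y ∈ Y), f ⟨y, Submodule.mem_sup_right hy⟩ = 0 :=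
    fun y hy => hfY ⟨y, Submodule.mem_sup_right hy⟩ hy
  have hbound : ∀ s, ‖f s‖ ≤ (‖z‖ * c) * ‖s‖ := by
    intro s
    obtain ⟨⟨x, y⟩, rfl, hp⟩ := hcT s
    have hsplit : T (x, y) = ⟨x, Submodule.mem_sup_left x.2⟩ + ⟨y, Submodule.mem_sup_right y.2⟩ :=
      rfl
    have hval : f (T (x, y)) = inner 𝕜 z (x : E) := by
      rw [hsplit, map_add, hf₁ _ x.2, hf₂ _ y.2, add_zero]
    calc ‖f (T (x, y))‖ ≤ ‖z‖ * ‖x‖ := by rw [hval]; exact norm_inner_le_norm _ _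
      _ ≤ ‖z‖ * (c * ‖T (x, y)‖) := by
        gcongr
        exact (norm_fst_le (x, y)).trans hp
      _ = (‖z‖ * c) * ‖T (x, y)‖ := by ring
  -- Riesz: `w` represents `f`, so it agrees with `z` against `X` and vanishes against `Y`.
  let w := (InnerProductSpace.toDual 𝕜 _).symm (f.mkContinuous _ hbound)
  have hw : ∀ s, inner 𝕜 w s = f s := fun s => by
    simp [w]
  refine Submodule.mem_sup.2 ⟨z - w, ?_, w, ?_, sub_add_cancel _ _⟩
  · refine (Submodule.mem_orthogonal' _ _).2 fun x hx => ?_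
    rw [inner_sub_left, sub_eq_zero, ← hf₁ x hx, ← hw]
    rfl
  · exact (Submodule.mem_orthogonal' _ _).2 fun y hy =>
      (hw ⟨y, Submodule.mem_sup_right hy⟩).trans (hf₂ y hy)

theorem isClosed_orthogonal_sup_of_isClosed_sup {𝕜 E : Type*} [RCLike 𝕜]
    [NormedAddCommGroup E] [InnerProductSpace 𝕜 E] [CompleteSpace E] {X Y : Submodule 𝕜 E}
    (hX : IsClosed (X : Set E)) (hY : IsClosed (Y : Set E))
    (h : IsClosed ((X ⊔ Y : Submodule 𝕜 E) : Set E)) :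
    IsClosed ((Xᗮ ⊔ Yᗮ : Submodule 𝕜 E) : Set E) := by
  have heq : Xᗮ ⊔ Yᗮ = (X ⊓ Y)ᗮ :=
    le_antisymm (sup_le (Submodule.orthogonal_le inf_le_left)
      (Submodule.orthogonal_le inf_le_right)) (orthogonal_inf_le_sup_of_isClosed_sup hX hY h)
  rw [heq]
  exact Submodule.isClosed_orthogonal _

/-- The sum of two closed subspaces of a Hilbert space is closed if and only if the sum of their
orthogonal complements is. -/
theorem isClosed_orthogonal_sup_iff {𝕜 E : Type*} [RCLike 𝕜]
    [NormedAddCommGroup E] [InnerProductSpace 𝕜 E] [CompleteSpace E] {X Y : Submodule 𝕜 E}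
    (hX : IsClosed (X : Set E)) (hY : IsClosed (Y : Set E)) :
    IsClosed ((Xᗮ ⊔ Yᗮ : Submodule 𝕜 E) : Set E) ↔
      IsClosed ((X ⊔ Y : Submodule 𝕜 E) : Set E) := by
  refine ⟨fun h => ?_, isClosed_orthogonal_sup_of_isClosed_sup hX hY⟩
  have := isClosed_orthogonal_sup_of_isClosed_sup (Submodule.isClosed_orthogonal X)
    (Submodule.isClosed_orthogonal Y) h
  rwa [Submodule.orthogonal_orthogonal_eq_closure, Submodule.orthogonal_orthogonal_eq_closure,
    hX.submodule_topologicalClosure_eq, hY.submodule_topologicalClosure_eq] at this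

/-- For closed subspaces, the orthogonal complement of the intersection is the closure of the sum
of the orthogonal complements. -/
theorem orthogonal_inf_eq_closure_sup {𝕜 E : Type*} [RCLike 𝕜]
    [NormedAddCommGroup E] [InnerProductSpace 𝕜 E] [CompleteSpace E] {X Y : Submodule 𝕜 E}
    (hX : IsClosed (X : Set E)) (hY : IsClosed (Y : Set E)) :
    (X ⊓ Y)ᗮ = (Xᗮ ⊔ Yᗮ).topologicalClosure := by
  rw [← Submodule.orthogonal_orthogonal_eq_closure, ← Submodule.inf_orthogonal,
    Submodule.orthogonal_orthogonal_eq_closure, Submodule.orthogonal_orthogonal_eq_closure,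
    hX.submodule_topologicalClosure_eq, hY.submodule_topologicalClosure_eq]

section

variable {𝕜 H K : Type*} [RCLike 𝕜] [NormedAddCommGroup H] [InnerProductSpace 𝕜 H]
  [NormedAddCommGroup K] [InnerProductSpace 𝕜 K]

/-- The graph of the restriction of `A` to `M`, in the Hilbert space sum of `H` and `K`. -/
def restrictedGraph (A : H →L[𝕜] K) (M : Submodule 𝕜 H) : Submodule 𝕜 (WithLp 2 (H × K)) where
  carrier := {p | p.fst ∈ M ∧ p.snd = A p.fst}
  add_mem' := by
    rintro p q ⟨hp, hp'⟩ ⟨hq, hq'⟩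
    exact ⟨M.add_mem hp hq, by simp [hp', hq']⟩
  zero_mem' := ⟨M.zero_mem, by simp⟩
  smul_mem' := by
    rintro c p ⟨hp, hp'⟩
    exact ⟨M.smul_mem c hp, by simp [hp']⟩

theorem isClosed_restrictedGraph (A : H →L[𝕜] K) {M : Submodule 𝕜 H}
    (hM : IsClosed (M : Set H)) : IsClosed (restrictedGraph A M : Set (WithLp 2 (H × K))) := by
  have h₁ : Continuous fun p : WithLp 2 (H × K) => p.fst := by fun_prop
  have h₂ : Continuous fun p : WithLp 2 (H × K) => p.snd := by fun_prop
  exact (hM.preimage h₁).inter (isClosed_eq h₂ (A.continuous.comp h₁))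

theorem mem_graph_inducedOperator_iff (A B : H →L[𝕜] K) (M N : Submodule 𝕜 H)
    (hAB : ∀ x ∈ M ⊓ N, A x = B x) (p : WithLp 2 (H × K)) :
    p.ofLp ∈ (inducedOperator M N A B hAB).graph ↔
      p ∈ restrictedGraph A M ⊔ restrictedGraph B N := by
  obtain ⟨-, hA, hB⟩ := (isSimultaneousExtension_iff M N A B hAB _).2 rfl
  have hval : ∀ (m : H) (hm : m ∈ M) (n : H) (hn : n ∈ N),
      inducedOperator M N A B hAB ⟨m + n, Submodule.add_mem_sup hm hn⟩ = A m + B n := by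
    intro m hm n hn
    rw [← hA ⟨m, Submodule.mem_sup_left hm⟩ hm, ← hB ⟨n, Submodule.mem_sup_right hn⟩ hn,
      ← LinearPMap.map_add]
    rfl
  constructor
  · intro h
    obtain ⟨⟨y, hy⟩, hy₁, hy₂⟩ := (LinearPMap.mem_graph_iff _).1 h
    obtain ⟨m, hm, n, hn, rfl⟩ := Submodule.mem_sup.1 hy
    refine Submodule.mem_sup.2 ⟨WithLp.toLp 2 (m, A m), ⟨hm, rfl⟩, WithLp.toLp 2 (n, B n),
      ⟨hn, rfl⟩, WithLp.ofLp_injective 2 (Prod.ext hy₁ ?_)⟩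
    exact (hval m hm n hn).symm.trans hy₂
  · intro h
    obtain ⟨a, ⟨ha, ha'⟩, b, ⟨hb, hb'⟩, rfl⟩ := Submodule.mem_sup.1 h
    refine (LinearPMap.mem_graph_iff _).2
      ⟨⟨a.fst + b.fst, Submodule.add_mem_sup ha hb⟩, rfl, ?_⟩
    rw [hval _ ha _ hb, ← ha', ← hb']
    rfl

variable [CompleteSpace H] [CompleteSpace K]

/-- Moving `A` across the inner product: ⟪(m, Am), (u, v)⟫ = ⟪m, u + A*v⟫. -/
theorem mem_orthogonal_restrictedGraph_iff (A : H →L[𝕜] K) (M : Submodule 𝕜 H)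
    (p : WithLp 2 (H × K)) :
    p ∈ (restrictedGraph A M)ᗮ ↔ p.fst + ContinuousLinearMap.adjoint A p.snd ∈ Mᗮ := by
  rw [Submodule.mem_orthogonal, Submodule.mem_orthogonal]
  have key : ∀ m : H, inner 𝕜 (WithLp.toLp 2 (m, A m)) p =
      inner 𝕜 m (p.fst + ContinuousLinearMap.adjoint A p.snd) := fun m => by
    rw [inner_add_right, ContinuousLinearMap.adjoint_inner_right, WithLp.prod_inner_apply]
    rfl
  constructor
  · intro h m hm
    rw [← key]
    exact h _ ⟨hm, rfl⟩
  · rintro h q ⟨hq, hq'⟩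
    rw [← h _ hq, ← key, ← hq']
    rfl

theorem mem_orthogonal_restrictedGraph_sup_iff (A B : H →L[𝕜] K) (M N : Submodule 𝕜 H)
    (p : WithLp 2 (H × K)) :
    p ∈ (restrictedGraph A M)ᗮ ⊔ (restrictedGraph B N)ᗮ ↔
      p.fst + ContinuousLinearMap.adjoint A p.snd ∈
        (ContinuousLinearMap.adjoint A - ContinuousLinearMap.adjoint B).range ⊔ Mᗮ ⊔ Nᗮ := by
  constructor
  · intro h
    obtain ⟨a, ha, b, hb, rfl⟩ := Submodule.mem_sup.1 h
    rw [mem_orthogonal_restrictedGraph_iff] at ha hb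
    have hsplit : (a + b).fst + ContinuousLinearMap.adjoint A (a + b).snd =
        (ContinuousLinearMap.adjoint A - ContinuousLinearMap.adjoint B) b.snd +
          (a.fst + ContinuousLinearMap.adjoint A a.snd) +
          (b.fst + ContinuousLinearMap.adjoint B b.snd) := by
      simp only [WithLp.add_fst, WithLp.add_snd, map_add, sub_apply]
      abel
    rw [hsplit]
    exact Submodule.add_mem_sup (Submodule.add_mem_sup ⟨_, rfl⟩ ha) hb
  · intro h
    obtain ⟨r, hr, n, hn, hrn⟩ := Submodule.mem_sup.1 h
    obtain ⟨_, ⟨w, rfl⟩, m, hm, rfl⟩ := Submodule.mem_sup.1 hr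
    -- The first component is forced by b.fst + B*w = n; the remainder `p - b` then yields exactly
    -- `m`.
    let b : WithLp 2 (H × K) := WithLp.toLp 2 (n - ContinuousLinearMap.adjoint B w, w)
    refine Submodule.mem_sup.2 ⟨p - b, ?_, b, ?_, sub_add_cancel _ _⟩
    · rw [mem_orthogonal_restrictedGraph_iff]
      have : (p - b).fst + ContinuousLinearMap.adjoint A (p - b).snd = m := by
        have hb₁ : b.fst = n - ContinuousLinearMap.adjoint B w := rfl
        have hb₂ : b.snd = w := rfl
        rw [WithLp.sub_fst, WithLp.sub_snd, map_sub, hb₁, hb₂]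
        have h₃ : p.fst = ContinuousLinearMap.adjoint A w - ContinuousLinearMap.adjoint B w + m + n
            - ContinuousLinearMap.adjoint A p.snd := eq_sub_of_add_eq hrn.symm
        rw [h₃]
        abel
      rwa [this]
    · rw [mem_orthogonal_restrictedGraph_iff]
      have : b.fst + ContinuousLinearMap.adjoint B b.snd = n := sub_add_cancel _ _
      rwa [this]

theorem isClosed_orthogonal_restrictedGraph_sup_iff (A B : H →L[𝕜] K) (M N : Submodule 𝕜 H) :
    IsClosed (((restrictedGraph A M)ᗮ ⊔ (restrictedGraph B N)ᗮ :
        Submodule 𝕜 (WithLp 2 (H × K))) : Set (WithLp 2 (H × K))) ↔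
      IsClosed (((ContinuousLinearMap.adjoint A - ContinuousLinearMap.adjoint B).range
        ⊔ Mᗮ ⊔ Nᗮ : Submodule 𝕜 H) : Set H) := by
  constructor
  · intro h
    -- On the slice v = 0 the map (u, v) ↦ u + A*v is the identity, so the slice recovers S.
    have hc : Continuous fun u : H => (WithLp.toLp 2 (u, 0) : WithLp 2 (H × K)) := by fun_prop
    convert h.preimage hc using 1
    ext u
    simp only [Set.mem_preimage, SetLike.mem_coe, mem_orthogonal_restrictedGraph_sup_iff]
    simp
  · intro h
    have hc : Continuous fun p : WithLp 2 (H × K) =>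
        p.fst + ContinuousLinearMap.adjoint A p.snd := by fun_prop
    convert h.preimage hc using 1
    ext p
    exact mem_orthogonal_restrictedGraph_sup_iff A B M N p

theorem isClosed_inducedOperator_iff (A B : H →L[𝕜] K) {M N : Submodule 𝕜 H}
    (hM : IsClosed (M : Set H)) (hN : IsClosed (N : Set H))
    (hAB : ∀ x ∈ M ⊓ N, A x = B x) :
    (inducedOperator M N A B hAB).IsClosed ↔
      IsClosed (((ContinuousLinearMap.adjoint A - ContinuousLinearMap.adjoint B).range
        ⊔ Mᗮ ⊔ Nᗮ : Submodule 𝕜 H) : Set H) := by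
  rw [← isClosed_orthogonal_restrictedGraph_sup_iff, isClosed_orthogonal_sup_iff
    (isClosed_restrictedGraph A hM) (isClosed_restrictedGraph B hN), LinearPMap.IsClosed,
    ← (WithLp.prodContinuousLinearEquiv 2 𝕜 H K).toHomeomorph.isClosed_preimage]
  have heq : (WithLp.prodContinuousLinearEquiv 2 𝕜 H K).toHomeomorph ⁻¹'
      ((inducedOperator M N A B hAB).graph : Set (H × K)) =
        (restrictedGraph A M ⊔ restrictedGraph B N : Submodule 𝕜 (WithLp 2 (H × K))) :=
    Set.ext fun p => mem_graph_inducedOperator_iff A B M N hAB p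
  rw [heq]

/-- `A` and `B` coincide on `L` if and only if the range of `A* - B*` is orthogonal to `L`. -/
theorem range_adjoint_sub_le_orthogonal_iff (A B : H →L[𝕜] K) (L : Submodule 𝕜 H) :
    (ContinuousLinearMap.adjoint A - ContinuousLinearMap.adjoint B).range ≤ Lᗮ ↔
      ∀ x ∈ L, A x = B x := by
  have key : ∀ x y, inner 𝕜 x
      ((ContinuousLinearMap.adjoint A - ContinuousLinearMap.adjoint B) y) =
        inner 𝕜 (A x - B x) y := fun x y => by
    rw [sub_apply, inner_sub_right, inner_sub_left,
      ContinuousLinearMap.adjoint_inner_right, ContinuousLinearMap.adjoint_inner_right]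
  constructor
  · intro h x hx
    -- Testing with y = Ax - Bx turns orthogonality into ‖Ax - Bx‖² = 0.
    have := Submodule.inner_right_of_mem_orthogonal hx (h ⟨A x - B x, rfl⟩)
    exact sub_eq_zero.1 (inner_self_eq_zero.1 ((key x _).symm.trans this))
  · rintro h _ ⟨y, rfl⟩
    refine (Submodule.mem_orthogonal _ _).2 fun x hx => (key x y).trans ?_
    rw [h x hx, sub_self, inner_zero_left]

theorem range_sup_eq_closure_iff_isClosed (A B : H →L[𝕜] K) {M N : Submodule 𝕜 H}
    (hM : IsClosed (M : Set H)) (hN : IsClosed (N : Set H))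
    (hAB : ∀ x ∈ M ⊓ N, A x = B x) :
    (ContinuousLinearMap.adjoint A - ContinuousLinearMap.adjoint B).range ⊔ Mᗮ ⊔ Nᗮ
        = (Mᗮ ⊔ Nᗮ).topologicalClosure ↔
      IsClosed (((ContinuousLinearMap.adjoint A - ContinuousLinearMap.adjoint B).range
        ⊔ Mᗮ ⊔ Nᗮ : Submodule 𝕜 H) : Set H) := by
  constructor
  · intro h
    rw [h]
    exact Submodule.isClosed_topologicalClosure _
  · intro h
    have hR := (range_adjoint_sub_le_orthogonal_iff A B (M ⊓ N)).2 hAB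
    rw [orthogonal_inf_eq_closure_sup hM hN] at hR
    rw [sup_assoc] at h ⊢
    exact le_antisymm (sup_le hR (Submodule.le_topologicalClosure _))
      (Submodule.topologicalClosure_minimal _ le_sup_right h)

end

theorem theorem4p6 {𝕜 H K : Type*} [RCLike 𝕜]
    [NormedAddCommGroup H] [InnerProductSpace 𝕜 H] [CompleteSpace H]
    [NormedAddCommGroup K] [InnerProductSpace 𝕜 K] [CompleteSpace K]
    (A B : H →L[𝕜] K) (M N : Submodule 𝕜 H)
    (hM : IsClosed (M : Set H)) (hN : IsClosed (N : Set H)) :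
    ((∃ C : H →ₗ.[𝕜] K, C.IsClosed ∧ IsSimultaneousExtension M N A B C) ↔
      (ContinuousLinearMap.adjoint A - ContinuousLinearMap.adjoint B).range ⊔ Mᗮ ⊔ Nᗮ
        = (Mᗮ ⊔ Nᗮ).topologicalClosure) ∧
    (∀ hAB : ∀ x ∈ M ⊓ N, A x = B x,
      ((inducedOperator M N A B hAB).IsClosed ↔
        (ContinuousLinearMap.adjoint A - ContinuousLinearMap.adjoint B).range ⊔ Mᗮ ⊔ Nᗮ
          = (Mᗮ ⊔ Nᗮ).topologicalClosure) ∧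
      ((inducedOperator M N A B hAB).IsClosed ↔
        IsClosed (((ContinuousLinearMap.adjoint A - ContinuousLinearMap.adjoint B).range
          ⊔ Mᗮ ⊔ Nᗮ : Submodule 𝕜 H) : Set H))) := by
  have main : ∀ hAB : ∀ x ∈ M ⊓ N, A x = B x, (inducedOperator M N A B hAB).IsClosed ↔
      (ContinuousLinearMap.adjoint A - ContinuousLinearMap.adjoint B).range ⊔ Mᗮ ⊔ Nᗮ
        = (Mᗮ ⊔ Nᗮ).topologicalClosure := fun hAB =>
    (isClosed_inducedOperator_iff A B hM hN hAB).trans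
      (range_sup_eq_closure_iff_isClosed A B hM hN hAB).symm
  refine ⟨⟨?_, fun h => ?_⟩, fun hAB => ⟨main hAB, isClosed_inducedOperator_iff A B hM hN hAB⟩⟩
  · rintro ⟨C, hC, hext⟩
    have hAB : ∀ x ∈ M ⊓ N, A x = B x := fun x hx =>
      have hxC : x ∈ C.domain := hext.1 ▸ Submodule.mem_sup_left hx.1
      (hext.2.1 ⟨x, hxC⟩ hx.1).symm.trans (hext.2.2 ⟨x, hxC⟩ hx.2)
    rw [isSimultaneousExtension_iff M N A B hAB] at hext
    exact (main hAB).1 (hext ▸ hC)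
  · have hAB : ∀ x ∈ M ⊓ N, A x = B x := by
      rw [← range_adjoint_sub_le_orthogonal_iff, orthogonal_inf_eq_closure_sup hM hN, ← h,
        sup_assoc]
      exact le_sup_left
    exact ⟨_, (main hAB).2 h, (isSimultaneousExtension_iff M N A B hAB _).2 rfl⟩
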